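/- For a finite-dimensional real vector space $V$, let $\Lambda^{p,q}(V)$ be the space of multilinear functionals $\varphi(X_1,\dots,X_p;Y_1,\dots,Y_q)$ on $V$ that are alternating in $X_1,\dots,X_p$ and alternating in $Y_1,\dots,Y_q$. Define $s:\Lambda^{p,q}\to\Lambda^{p+1,q-1}$ and $s^*:\Lambda^{p,q}\to\Lambda^{p-1,q+1}$ by $$(s\varphi)(X_1,\dots,X_{p+1};Y_1,\dots,Y_{q-1})=\sum_{a=1}^{p+1}(-1)^{a-1}\varphi(X_1,\dots,\widehat{X_a},\dots,X_{p+1};X_a,Y_1,\dots,Y_{q-1}),$$ $$(s^*\varphi)(X_1,\dots,X_{p-1};Y_1,\dots,Y_{q+1})=\sum_{a=1}^{q+1}(-1)^{a-1}\varphi(Y_a,X_1,\dots,X_{p-1};Y_1,\dots,\widehat{Y_a},\dots,Y_{q+1}),$$ where a space with a negative index is zero. For an integer $m\ge 0$ let $\Lambda^{p,q}_m(V)$ be the eigenspace of $s^*s:\Lambda^{p,q}\to\Lambda^{p,q}$ for the eigenvalue $m(m+p-q+1)$. Let $T^n=\{(\lambda_0,\dots,\lambda_n)\in\mathbb{R}^{n+1}:\lambda_i\ge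 0,\ \sum_i\lambda_i=1\}$ be the standard simplex; its tangent space at every point is $H=\{v\in\mathbb{R}^{n+1}:\sum_i v_i=0\}$. Let $\mathring{\mathcal P}_0\Lambda^{p,q}_m(T^n)$ be the space of $(p,q)$-forms on $T^n$ (fields of elements of $\Lambda^{p,q}(H)$) that have constant coefficients, take values in $\Lambda^{p,q}_m(H)$, and have vanishing trace, i.e. at each point of the boundary $\partial T^n$ they vanish on vectors tangent to the boundary: whenever $\lambda_i=0$, the form at $\lambda$ vanishes on all vectors $v\in H$ with $v_i=0$. Let $p,q,n\ge 0$ and $\max\{0,q-p\}\le m\le q-1$ be integers. Then $\mathring{\mathcal P}_0\Lambda^{p,q}_m(T^n)$ is finite-dimensional and $$\dim\mathring{\mathcal P}_0\Lambda^{p,q}_m(T^n)=\binom{n+1}{q-m}\binom{q-m-1}{p+q-n-1}-\binom{n+1}{p+m+1}\binom{p+m}{p+q-n-1}=\frac{p-q+2m+1}{p+m+1}\binom{n+1}{q-m}\binom{q-m-1}{n-p-m},$$ where $\binom{a}{b}=0$ if $b<0$ or $b>a$. -/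

import Mathlib

open Module

namespace DoubleForms

section Covectors

variable (V : Type*) [AddCommGroup V] [Module ℝ V]

/-- The space `Λ^{p,q}` of `(p,q)`-covectors on `V`: real multilinear functionals of `p + q` vectors
which are alternating in the first `p` and alternating in the last `q` arguments, written
`φ X Y` with `X : Fin p → V` and `Y : Fin q → V`. -/
def DoubleCovector (p q : ℕ) : Type _ :=
  V [⋀^Fin p]→ₗ[ℝ] (V [⋀^Fin q]→ₗ[ℝ] ℝ)

variable {V}

namespace DoubleCovector

variable {p q : ℕ}

noncomputable instance : AddCommGroup (DoubleCovector V p q) :=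
  inferInstanceAs (AddCommGroup (V [⋀^Fin p]→ₗ[ℝ] (V [⋀^Fin q]→ₗ[ℝ] ℝ)))

noncomputable instance : Module ℝ (DoubleCovector V p q) :=
  inferInstanceAs (Module ℝ (V [⋀^Fin p]→ₗ[ℝ] (V [⋀^Fin q]→ₗ[ℝ] ℝ)))

instance : FunLike (DoubleCovector V p q) (Fin p → V) (V [⋀^Fin q]→ₗ[ℝ] ℝ) :=
  inferInstanceAs (FunLike (V [⋀^Fin p]→ₗ[ℝ] (V [⋀^Fin q]→ₗ[ℝ] ℝ)) _ _)

variable (V p q) in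
/-- A `(p,q)`-covector regarded as an alternating map with values in alternating maps. -/
noncomputable def toAlternating :
    DoubleCovector V p q ≃ₗ[ℝ] (V [⋀^Fin p]→ₗ[ℝ] (V [⋀^Fin q]→ₗ[ℝ] ℝ)) where
  toFun φ := φ
  invFun φ := φ
  map_add' _ _ := rfl
  map_smul' _ _ := rfl
  left_inv _ := rfl
  right_inv _ := rfl

@[simp] theorem toAlternating_apply (φ : DoubleCovector V p q) (X : Fin p → V) :
    toAlternating V p q φ X = φ X := rfl

@[simp] theorem add_apply (φ ψ : DoubleCovector V p q) (X : Fin p → V) :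
    (φ + ψ) X = φ X + ψ X := rfl

@[simp] theorem smul_apply (c : ℝ) (φ : DoubleCovector V p q) (X : Fin p → V) :
    (c • φ) X = c • φ X := rfl

@[simp] theorem zero_apply (X : Fin p → V) : (0 : DoubleCovector V p q) X = 0 := rfl

@[ext] theorem ext {φ ψ : DoubleCovector V p q}
    (h : ∀ (X : Fin p → V) (Y : Fin q → V), φ X Y = ψ X Y) : φ = ψ :=
  AlternatingMap.ext fun X => AlternatingMap.ext fun Y => h X Y

end DoubleCovector

/-- Feeding a vector `y` into the first of the last `q + 1` slots: `(X; Y) ↦ φ (X; y, Y)`,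
linearly in `y`. -/
noncomputable def insertRight {p q : ℕ} (φ : DoubleCovector V p (q + 1)) :
    V →ₗ[ℝ] (V [⋀^Fin p]→ₗ[ℝ] (V [⋀^Fin q]→ₗ[ℝ] ℝ)) where
  toFun y := (AlternatingMap.curryLeftLinearMap.flip y).compAlternatingMap
    (DoubleCovector.toAlternating V p (q + 1) φ)
  map_add' x y := by ext; simp
  map_smul' c x := by ext; simp

/-- Feeding a vector `y` into the first of the first `p + 1` slots: `(X; Y) ↦ φ (y, X; Y)`,
as an alternating function of `X`, linear in `y`. -/
noncomputable def insertLeft {p q : ℕ} (φ : DoubleCovector V (p + 1) q) :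
    V [⋀^Fin p]→ₗ[ℝ] (V →ₗ[ℝ] (V [⋀^Fin q]→ₗ[ℝ] ℝ)) where
  toFun X :=
    { toFun := fun y => (DoubleCovector.toAlternating V (p + 1) q φ).curryLeft y X
      map_add' := by intro x y; simp
      map_smul' := by intro c x; simp }
  map_update_add' X i x y := by ext z; simp
  map_update_smul' X i c x := by ext z; simp
  map_eq_zero_of_eq' X i j h hij := by
    ext1 z
    exact ((DoubleCovector.toAlternating V (p + 1) q φ).curryLeft z).map_eq_zero_of_eq X h hij

/-- The Bianchi sum `s : Λ^{p,q+1} → Λ^{p+1,q}`; see `bianchi_apply` for the formula. -/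
noncomputable def bianchi (p q : ℕ) :
    DoubleCovector V p (q + 1) →ₗ[ℝ] DoubleCovector V (p + 1) q where
  toFun φ := (DoubleCovector.toAlternating V (p + 1) q).symm
    (AlternatingMap.alternatizeUncurryFin (insertRight φ))
  map_add' φ ψ := by
    rw [← map_add, ← AlternatingMap.alternatizeUncurryFin_add]; rfl
  map_smul' c φ := by
    rw [RingHom.id_apply, ← map_smul, ← AlternatingMap.alternatizeUncurryFin_smul]; rfl

/-- The dual Bianchi sum `s* : Λ^{p+1,q} → Λ^{p,q+1}`; see `bianchiStar_apply` for the formula. -/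
noncomputable def bianchiStar (p q : ℕ) :
    DoubleCovector V (p + 1) q →ₗ[ℝ] DoubleCovector V p (q + 1) where
  toFun φ := (DoubleCovector.toAlternating V p (q + 1)).symm
    (AlternatingMap.alternatizeUncurryFinLM.compAlternatingMap (insertLeft φ))
  map_add' φ ψ := by
    rw [← map_add, ← LinearMap.compAlternatingMap_add]; rfl
  map_smul' c φ := by
    rw [RingHom.id_apply, ← map_smul, ← LinearMap.compAlternatingMap_smul]; rfl

/-- `(sφ)(X₀,…,X_p; Y) = ∑ₐ (-1)^a φ(X₀,…,X̂ₐ,…,X_p; Xₐ, Y)`. -/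
theorem bianchi_apply {p q : ℕ} (φ : DoubleCovector V p (q + 1))
    (X : Fin (p + 1) → V) (Y : Fin q → V) :
    bianchi p q φ X Y =
      ∑ a : Fin (p + 1), (-1 : ℝ) ^ (a : ℕ) * φ (a.removeNth X) (Fin.cons (X a) Y) := by
  let ev : (V [⋀^Fin q]→ₗ[ℝ] ℝ) →+ ℝ :=
    { toFun := fun β => β Y, map_zero' := rfl, map_add' := fun _ _ => rfl }
  change ev (AlternatingMap.alternatizeUncurryFin (insertRight φ) X) = _
  rw [AlternatingMap.alternatizeUncurryFin_apply, map_sum]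
  refine Finset.sum_congr rfl fun a _ => ?_
  rw [map_zsmul, zsmul_eq_mul]
  push_cast
  rfl

/-- `(s*φ)(X; Y₀,…,Y_q) = ∑ₐ (-1)^a φ(Yₐ, X; Y₀,…,Ŷₐ,…,Y_q)`. -/
theorem bianchiStar_apply {p q : ℕ} (φ : DoubleCovector V (p + 1) q)
    (X : Fin p → V) (Y : Fin (q + 1) → V) :
    bianchiStar p q φ X Y =
      ∑ a : Fin (q + 1), (-1 : ℝ) ^ (a : ℕ) * φ (Fin.cons (Y a) X) (a.removeNth Y) := by
  change AlternatingMap.alternatizeUncurryFin (insertLeft φ X) Y = _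
  rw [AlternatingMap.alternatizeUncurryFin_apply]
  refine Finset.sum_congr rfl fun a _ => ?_
  rw [zsmul_eq_mul]
  push_cast
  rfl

/-- The operator `s*s : Λ^{p,q} → Λ^{p,q}`. For `q = 0` it is zero, since `s` then maps
into `Λ^{p+1,-1} = 0`. -/
noncomputable def bianchiStarBianchi (p : ℕ) : (q : ℕ) → End ℝ (DoubleCovector V p q)
  | 0 => 0
  | q + 1 => bianchiStar p q ∘ₗ bianchi p q

variable (V) in
/-- The summand `Λ^{p,q}_m`: the eigenspace of `s*s` for the eigenvalue `m (m + p - q + 1)`. -/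
noncomputable def summand (p q m : ℕ) : Submodule ℝ (DoubleCovector V p q) :=
  End.eigenspace (bianchiStarBianchi p q) ((m : ℝ) * ((m : ℝ) + p - q + 1))

end Covectors

section Simplex

/-- The tangent space of the standard simplex `T^n ⊆ ℝ^{n+1}` (at any of its points): the vectors
whose coordinates sum to zero. -/
def simplexTangent (n : ℕ) : Submodule ℝ (Fin (n + 1) → ℝ) where
  carrier := {v | ∑ i, v i = 0}
  add_mem' {v w} hv hw := by
    simp only [Set.mem_ofPred_eq] at hv hw ⊢
    simp [Finset.sum_add_distrib, hv, hw]
  zero_mem' := by simp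
  smul_mem' c v hv := by
    simp only [Set.mem_ofPred_eq] at hv ⊢
    simp [← Finset.mul_sum, hv]

/-- Fields of `(p,q)`-covectors on the standard simplex `T^n`. -/
abbrev DoubleField (n p q : ℕ) : Type :=
  stdSimplex ℝ (Fin (n + 1)) → DoubleCovector (simplexTangent n) p q

/-- `f : T^n → ℝ` is the restriction of a polynomial of degree at most `r`. -/
def IsPolynomialOfDegreeLE {n : ℕ} (r : ℕ) (f : stdSimplex ℝ (Fin (n + 1)) → ℝ) : Prop :=
  ∃ P : MvPolynomial (Fin (n + 1)) ℝ, P.totalDegree ≤ r ∧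
    ∀ x : stdSimplex ℝ (Fin (n + 1)), f x = MvPolynomial.eval (x : Fin (n + 1) → ℝ) P

/-- `P_r Λ^{p,q}(T^n)`: the `(p,q)`-forms on `T^n` with polynomial coefficients of degree at
most `r`, that is, whose values on all tuples of constant tangent vectors are such polynomials. -/
def polyForms (n p q r : ℕ) : Submodule ℝ (DoubleField n p q) where
  carrier := {φ | ∀ (X : Fin p → simplexTangent n) (Y : Fin q → simplexTangent n),
    IsPolynomialOfDegreeLE r fun x => φ x X Y}
  add_mem' {φ ψ} hφ hψ X Y := by
    obtain ⟨P, hP, hP'⟩ := hφ X Y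
    obtain ⟨Q, hQ, hQ'⟩ := hψ X Y
    refine ⟨P + Q, (MvPolynomial.totalDegree_add P Q).trans (max_le hP hQ), fun x => ?_⟩
    have h1 := hP' x
    have h2 := hQ' x
    simp only at h1 h2
    simp [h1, h2]
  zero_mem' X Y := ⟨0, by simp, fun x => by simp⟩
  smul_mem' c φ hφ X Y := by
    obtain ⟨P, hP, hP'⟩ := hφ X Y
    refine ⟨c • P, (MvPolynomial.totalDegree_smul_le c P).trans hP, fun x => ?_⟩
    have h1 := hP' x
    simp only at h1
    simp [h1]

/-- The `(p,q)`-forms on `T^n` with vanishing trace: at every point of the boundary, that is on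
every facet `{x i = 0}` of `T^n`, they vanish on vectors tangent to that facet. -/
def vanishingTrace (n p q : ℕ) : Submodule ℝ (DoubleField n p q) where
  carrier := {φ | ∀ (x : stdSimplex ℝ (Fin (n + 1))) (i : Fin (n + 1)),
    (x : Fin (n + 1) → ℝ) i = 0 →
    ∀ (X : Fin p → simplexTangent n) (Y : Fin q → simplexTangent n),
      (∀ j, (X j : Fin (n + 1) → ℝ) i = 0) → (∀ j, (Y j : Fin (n + 1) → ℝ) i = 0) →
        φ x X Y = 0}
  add_mem' {φ ψ} hφ hψ x i hx X Y hX hY := by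
    simp [hφ x i hx X Y hX hY, hψ x i hx X Y hX hY]
  zero_mem' x i hx X Y hX hY := by simp
  smul_mem' c φ hφ x i hx X Y hX hY := by
    simp [hφ x i hx X Y hX hY]

/-- The `(p,q)`-forms on `T^n` that lie pointwise in the summand `Λ^{p,q}_m`. -/
noncomputable def summandForms (n p q m : ℕ) : Submodule ℝ (DoubleField n p q) :=
  Submodule.pi Set.univ fun _ => summand (simplexTangent n) p q m

/-- The vanishing trace subspace of `P_r Λ^{p,q}_m(T^n)`. -/
noncomputable def traceFreePolyForms (n p q m r : ℕ) : Submodule ℝ (DoubleField n p q) :=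
  polyForms n p q r ⊓ summandForms n p q m ⊓ vanishingTrace n p q

end Simplex

/-- The binomial coefficient `a` choose `b` for `a ≥ 0` and an integer `b`; it is zero for
`b < 0` (and for `b > a`). -/
def binom (a : ℕ) (b : ℤ) : ℕ :=
  if 0 ≤ b then a.choose b.toNat else 0

end DoubleForms

/-! Write `B^{p,q}` for the covectors on `H` that vanish on every facet direction `{v_i = 0}`. For
`n ≥ 1` a constant field has vanishing trace exactly when its value lies in `B^{p,q}`, so the space
in question is the part of `B^{p,q}` in `Λ^{p,q}_m`.

Both Bianchi sums preserve `B`, and `s s* - s* s = p - q` (`bianchi_bianchiStar`), an `sl₂`-type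
relation. It rules out negative eigenvalues of `s* s` for `q ≤ p + 2`. Hence `s : B^{P,Q+1} →
B^{P+1,Q}` is onto for `Q ≤ P`, with kernel the summand `m = 0`, while `s^m` identifies the summand
`m` in bidegree `(p,q)` with the summand `0` in bidegree `(p+m,q-m)`. With `P = p + m` and `Q = q -
m - 1` the dimension is therefore `dim B^{P,Q+1} - dim B^{P+1,Q}`
(`BianchiStable.finrank_inf_summand`).

Only this difference has to be computed. In the coordinates `λ_1, …, λ_n` on `H` put `σ = ∑ λ_i =
-λ_0`. Let `C` be the covectors vanishing on all coordinate hyperplanes, `L ⊆ C` those divisible by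
`σ` on the left, and `D ⊆ L` those divisible by `σ` on both sides. Left multiplication by `σ` gives
an exact sequence `0 → L^{a,b} → B^{a,b} → D^{a+1,b} → 0` for `b ≥ 1` (`finrank_leftDivisible_add`);
surjectivity comes from an explicit homotopy. Exchanging the two groups of arguments identifies
`D^{P+1,Q+1}` with `D^{Q+1,P+1}` and `B^{P+1,Q}` with `B^{Q,P+1}`, so `D` cancels and the difference
is `dim L^{P,Q+1} - dim L^{Q,P+1}` (`finrank_bubbles_add`).

The same sequence without the condition on the right arguments reads `dim L^{a,b} + dim L^{a+1,b} =
dim C^{a,b}`. Here `dim C^{a,b}` counts pairs of index sets that cover all indices, and Pascal's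
rule solves the recursion. -/

namespace DoubleForms

/-! ### The commutation relation of the two Bianchi sums. -/

section Commutator

variable {V : Type*} [AddCommGroup V] [Module ℝ V] {p q : ℕ}

theorem neg_one_pow_smul_map_cons_removeNth {N : Type*} [AddCommGroup N] [Module ℝ N] {k : ℕ}
    (β : V [⋀^Fin (k + 1)]→ₗ[ℝ] N) (X : Fin (k + 1) → V) (a : Fin (k + 1)) :
    (-1 : ℝ) ^ (a : ℕ) • β (Fin.cons (X a) (a.removeNth X)) = β X := by
  have h := β.map_insertNth a (X a) (a.removeNth X)
  rw [Fin.insertNth_self_removeNth] at h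
  rw [h]
  rcases neg_one_pow_eq_or ℤ (a : ℕ) with h1 | h1 <;>
  rcases Nat.even_or_odd (a : ℕ) with h2 | h2 <;> simp_all [Matrix.vecCons]

theorem DoubleCovector.neg_one_pow_mul_cons_removeNth_left (φ : DoubleCovector V (p + 1) q)
    (X : Fin (p + 1) → V) (Y : Fin q → V) (a : Fin (p + 1)) :
    (-1 : ℝ) ^ (a : ℕ) * φ (Fin.cons (X a) (a.removeNth X)) Y = φ X Y :=
  DFunLike.congr_fun
    (neg_one_pow_smul_map_cons_removeNth (DoubleCovector.toAlternating V (p + 1) q φ) X a) Y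

theorem DoubleCovector.neg_one_pow_mul_cons_removeNth_right (φ : DoubleCovector V p (q + 1))
    (X : Fin p → V) (Y : Fin (q + 1) → V) (a : Fin (q + 1)) :
    (-1 : ℝ) ^ (a : ℕ) * φ X (Fin.cons (Y a) (a.removeNth Y)) = φ X Y :=
  neg_one_pow_smul_map_cons_removeNth (φ X) Y a

theorem removeNth_zero_cons {α : Type*} {k : ℕ} (x : α) (X : Fin k → α) :
    (0 : Fin (k + 1)).removeNth (Fin.cons x X : Fin (k + 1) → α) = X := by
  ext i; simp [Fin.removeNth]

theorem removeNth_succ_cons {α : Type*} {k : ℕ} (x : α) (X : Fin (k + 1) → α) (a : Fin (k + 1)) :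
    a.succ.removeNth (Fin.cons x X : Fin (k + 2) → α) = Fin.cons x (a.removeNth X) := by
  ext i
  refine Fin.cases ?_ (fun i => ?_) i <;> simp [Fin.removeNth]

/-- The commutation relation `s s* - s* s = p - q` on `Λ^{p,q}`. -/
theorem bianchi_bianchiStar (φ : DoubleCovector V (p + 1) q) :
    bianchi p q (bianchiStar p q φ)
      = bianchiStarBianchi (p + 1) q φ + (((p + 1 : ℕ) : ℝ) - q) • φ := by
  cases q with
  | zero =>
    ext X Y
    simp only [bianchiStarBianchi, LinearMap.zero_apply, zero_add, bianchi_apply,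
      bianchiStar_apply, DoubleCovector.smul_apply, AlternatingMap.smul_apply]
    simp [φ.neg_one_pow_mul_cons_removeNth_left]
  | succ q =>
    ext X Y
    simp only [bianchiStarBianchi, LinearMap.comp_apply, bianchi_apply, DoubleCovector.add_apply,
      bianchiStar_apply, DoubleCovector.smul_apply, AlternatingMap.smul_apply,
      AlternatingMap.add_apply]
    -- Split off the inner summand that reinserts the vector just moved. It returns `φ` itself, `p +
    -- 1` times in `s s*` and `q + 1` times in `s* s`; the remaining double sums agree after
    -- exchanging the order of summation.
    simp only [Fin.sum_univ_succ (n := q + 1), Fin.sum_univ_succ (n := p + 1), Fin.cons_zero,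
      Fin.cons_succ, removeNth_zero_cons, removeNth_succ_cons, mul_add, Finset.sum_add_distrib,
      Fin.val_zero, pow_zero, one_mul, φ.neg_one_pow_mul_cons_removeNth_left,
      φ.neg_one_pow_mul_cons_removeNth_right, Finset.mul_sum]
    rw [Finset.sum_comm]
    simp only [Finset.sum_const, Finset.card_univ, Fintype.card_fin, nsmul_eq_mul, smul_eq_mul,
      Fin.val_succ]
    have h : ∀ (a : Fin (p + 1)) (b : Fin (q + 1)) (x : ℝ),
        (-1 : ℝ) ^ (a : ℕ) * ((-1) ^ ((b : ℕ) + 1) * x)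
          = (-1) ^ (b : ℕ) * ((-1) ^ ((a : ℕ) + 1) * x) := by intros; ring
    simp only [h]
    push_cast
    ring

end Commutator

/-! ### Eigenspaces of `s* s` in families stable under `s` and `s*`. -/

section Ladder

variable {V : Type*} [AddCommGroup V] [Module ℝ V]

/-- `s*s` has no negative eigenvalues on `Λ^{p,q}` when `q ≤ p + 2`. -/
theorem eq_zero_of_bianchiStarBianchi_eq_neg_smul {p q : ℕ} (hpq : q ≤ p + 2) {c : ℝ} (hc : 0 < c)
    (φ : DoubleCovector V p q) (h : bianchiStarBianchi p q φ = -c • φ) : φ = 0 := by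
  induction q generalizing p c with
  | zero =>
    have h' : -c • φ = 0 := h.symm
    exact (smul_eq_zero.1 h').resolve_left (by linarith)
  | succ q ih =>
    -- By the commutation relation `sφ` has eigenvalue `-(c + p + 1 - q) ≤ -c`, still negative. The
    -- descent in `q` ends at `q = 0`, where `s* s = 0`.
    have h1 : bianchiStarBianchi (p + 1) q (bianchi p q φ)
        = -(c + ((p + 1 : ℕ) - q : ℝ)) • bianchi p q φ := by
      have h2 := bianchi_bianchiStar (bianchi p q φ)
      have h3 : bianchiStar p q (bianchi p q φ) = -c • φ := h
      rw [h3, map_smul] at h2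
      rw [neg_add, add_smul, h2, neg_smul, add_neg_cancel_right]
    have hq : (q : ℝ) ≤ (p + 1 : ℕ) := by exact_mod_cast (by omega)
    have h4 : bianchi p q φ = 0 := ih (by omega) (by linarith) _ h1
    have h' : bianchiStar p q (bianchi p q φ) = -c • φ := h
    rw [h4, map_zero] at h'
    exact (smul_eq_zero.1 h'.symm).resolve_left (by linarith)

/-- `s s*` is injective on `Λ^{p+1,q}` for `q ≤ p`. -/
theorem eq_zero_of_bianchi_bianchiStar_eq_zero {p q : ℕ} (hpq : q ≤ p)
    (φ : DoubleCovector V (p + 1) q) (h : bianchi p q (bianchiStar p q φ) = 0) : φ = 0 := by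
  have hq : (q : ℝ) ≤ p := by exact_mod_cast hpq
  refine eq_zero_of_bianchiStarBianchi_eq_neg_smul (by omega)
    (c := ((p + 1 : ℕ) : ℝ) - q) (by push_cast; linarith) φ ?_
  rw [bianchi_bianchiStar] at h
  rw [neg_smul]
  exact eq_neg_of_add_eq_zero_left h

/-- A bigraded family of spaces of double covectors stable under both Bianchi sums. -/
structure BianchiStable (B : ∀ p q : ℕ, Submodule ℝ (DoubleCovector V p q)) : Prop where
  bianchi_mem : ∀ {p q : ℕ} {φ : DoubleCovector V p (q + 1)}, φ ∈ B p (q + 1) →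
    bianchi p q φ ∈ B (p + 1) q
  bianchiStar_mem : ∀ {p q : ℕ} {φ : DoubleCovector V (p + 1) q}, φ ∈ B (p + 1) q →
    bianchiStar p q φ ∈ B p (q + 1)

variable {B : ∀ p q : ℕ, Submodule ℝ (DoubleCovector V p q)}

/-- Since `s s*` is injective on the finite-dimensional `B (p + 1) q`, it is bijective there and `s`
is onto. Moreover `s* s φ = 0` gives `s s* (sφ) = 0`, hence `sφ = 0`, so the eigenspace for `0` is
the kernel of `s`; rank-nullity concludes. -/
theorem BianchiStable.finrank_inf_summand_zero (hB : BianchiStable B) {p q : ℕ} (hpq : q ≤ p)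
    [∀ p q, Module.Finite ℝ (DoubleCovector V p q)] :
    finrank ℝ ↥(B p (q + 1) ⊓ summand V p (q + 1) 0) + finrank ℝ (B (p + 1) q)
      = finrank ℝ (B p (q + 1)) := by
  let S : B p (q + 1) →ₗ[ℝ] B (p + 1) q :=
    (bianchi p q).restrict fun φ hφ => hB.bianchi_mem hφ
  let T : B (p + 1) q →ₗ[ℝ] B p (q + 1) :=
    (bianchiStar p q).restrict fun φ hφ => hB.bianchiStar_mem hφ
  have hinj : Function.Injective (S ∘ₗ T) := by
    refine (injective_iff_map_eq_zero _).2 fun φ hφ => Subtype.ext ?_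
    exact eq_zero_of_bianchi_bianchiStar_eq_zero hpq _ (congrArg Subtype.val hφ)
  have hsurj : Function.Surjective S := by
    have := LinearMap.injective_iff_surjective.1 hinj
    exact Function.Surjective.of_comp (g := T) this
  have hker : (LinearMap.ker S).map (B p (q + 1)).subtype
      = B p (q + 1) ⊓ summand V p (q + 1) 0 := by
    ext φ
    simp only [Submodule.mem_map, LinearMap.mem_ker, Submodule.subtype_apply, Submodule.mem_inf,
      summand, End.mem_eigenspace_iff, Nat.cast_zero, zero_mul, zero_smul]
    constructor
    · rintro ⟨⟨ψ, hψ⟩, h, rfl⟩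
      refine ⟨hψ, ?_⟩
      change bianchiStar p q (bianchi p q ψ) = 0
      rw [show bianchi p q ψ = 0 from congrArg Subtype.val h, map_zero]
    · rintro ⟨hφ, h⟩
      refine ⟨⟨φ, hφ⟩, Subtype.ext ?_, rfl⟩
      refine eq_zero_of_bianchi_bianchiStar_eq_zero hpq (bianchi p q φ) ?_
      rw [show bianchiStar p q (bianchi p q φ) = 0 from h, map_zero]
  rw [← hker, Submodule.finrank_map_subtype_eq, ← LinearMap.finrank_range_add_finrank_ker S,
    LinearMap.range_eq_top.2 hsurj, finrank_top, add_comm]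

/-- The commutation relation turns the eigenvalue `m (m + p - q + 2)` of `s* s` in bidegree `(p + 1,
q)` into the eigenvalue `c = (m + 1)(m + 1 + p - q) > 0` of `s s*`. Thus `s` and `c⁻¹ s*` are
mutually inverse. -/
theorem BianchiStable.finrank_inf_summand_succ (hB : BianchiStable B) {p q m : ℕ}
    (hpq : q ≤ p + m) :
    finrank ℝ ↥(B p (q + 1) ⊓ summand V p (q + 1) (m + 1))
      = finrank ℝ ↥(B (p + 1) q ⊓ summand V (p + 1) q m) := by
  set c : ℝ := ((m + 1 : ℕ) : ℝ) * (((m + 1 : ℕ) : ℝ) + p - (q + 1 : ℕ) + 1) with hc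
  have hc0 : 0 < c := by
    have : (q : ℝ) ≤ p + m := by exact_mod_cast hpq
    rw [hc]
    push_cast
    have h1 : (0 : ℝ) < m + 1 := by positivity
    exact mul_pos h1 (by linarith)
  have hS : ∀ φ ∈ B p (q + 1) ⊓ summand V p (q + 1) (m + 1),
      bianchiStar p q (bianchi p q φ) = c • φ := fun φ hφ => End.mem_eigenspace_iff.1 hφ.2
  have hT : ∀ φ ∈ B (p + 1) q ⊓ summand V (p + 1) q m,
      bianchi p q (bianchiStar p q φ) = c • φ := fun φ hφ => by
    rw [bianchi_bianchiStar, End.mem_eigenspace_iff.1 hφ.2, ← add_smul, hc]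
    congr 1
    push_cast
    ring
  let S : ↥(B p (q + 1) ⊓ summand V p (q + 1) (m + 1)) →ₗ[ℝ]
      ↥(B (p + 1) q ⊓ summand V (p + 1) q m) :=
    (bianchi p q).restrict fun φ hφ => by
      refine ⟨hB.bianchi_mem hφ.1, End.mem_eigenspace_iff.2 ?_⟩
      have h := bianchi_bianchiStar (bianchi p q φ)
      rw [hS φ hφ, map_smul] at h
      rw [← sub_eq_iff_eq_add, ← sub_smul] at h
      rw [← h, hc]
      congr 1
      push_cast
      ring
  let T : ↥(B (p + 1) q ⊓ summand V (p + 1) q m) →ₗ[ℝ]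
      ↥(B p (q + 1) ⊓ summand V p (q + 1) (m + 1)) :=
    (bianchiStar p q).restrict fun φ hφ => by
      refine ⟨hB.bianchiStar_mem hφ.1, End.mem_eigenspace_iff.2 ?_⟩
      change bianchiStar p q (bianchi p q (bianchiStar p q φ)) = _
      rw [hT φ hφ, map_smul]
  refine LinearEquiv.finrank_eq (LinearEquiv.ofBijective S ⟨?_, fun ψ => ⟨c⁻¹ • T ψ, ?_⟩⟩)
  · refine (injective_iff_map_eq_zero S).2 fun φ hφ => Subtype.ext ?_
    have h : bianchi p q φ.1 = 0 := congrArg Subtype.val hφ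
    have h' := hS φ.1 φ.2
    rw [h, map_zero] at h'
    exact (smul_eq_zero.1 h'.symm).resolve_left hc0.ne'
  · rw [map_smul]
    refine Subtype.ext ?_
    have h' := hT ψ.1 ψ.2
    change c⁻¹ • bianchi p q (bianchiStar p q ψ.1) = ψ.1
    rw [h', inv_smul_smul₀ hc0.ne']

theorem BianchiStable.finrank_inf_summand (hB : BianchiStable B)
    [∀ p q, Module.Finite ℝ (DoubleCovector V p q)] (m : ℕ) :
    ∀ {p q P Q : ℕ}, P = p + m → q = Q + 1 + m → Q + 1 ≤ p →
      finrank ℝ ↥(B p q ⊓ summand V p q m) + finrank ℝ (B (P + 1) Q)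
        = finrank ℝ (B P (Q + 1)) := by
  induction m with
  | zero =>
    rintro p q P Q rfl rfl h
    exact hB.finrank_inf_summand_zero (by omega)
  | succ m ih =>
    rintro p q P Q rfl rfl h
    rw [← add_assoc (Q + 1), hB.finrank_inf_summand_succ (by omega)]
    exact ih (by omega) rfl (by omega)

end Ladder

/-! ### Exterior multiplication by a covector. -/

section Wedge

variable {V N : Type*} [AddCommGroup V] [Module ℝ V] [AddCommGroup N] [Module ℝ N] {k : ℕ}

/-- The wedge product `σ ∧ β` of a covector with an alternating map. -/
noncomputable def wedge (σ : V →ₗ[ℝ] ℝ) : (V [⋀^Fin k]→ₗ[ℝ] N) →ₗ[ℝ] V [⋀^Fin (k + 1)]→ₗ[ℝ] N :=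
  AlternatingMap.alternatizeUncurryFinLM ∘ₗ LinearMap.smulRightₗ σ

theorem wedge_apply (σ : V →ₗ[ℝ] ℝ) (β : V [⋀^Fin k]→ₗ[ℝ] N) (X : Fin (k + 1) → V) :
    wedge σ β X = ∑ a : Fin (k + 1), (-1 : ℝ) ^ (a : ℕ) • σ (X a) • β (a.removeNth X) := by
  change AlternatingMap.alternatizeUncurryFin (σ.smulRight β) X = _
  rw [AlternatingMap.alternatizeUncurryFin_apply]
  refine Finset.sum_congr rfl fun a _ => ?_
  rcases neg_one_pow_eq_or ℤ (a : ℕ) with h1 | h1 <;>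
  rcases Nat.even_or_odd (a : ℕ) with h2 | h2 <;> simp_all

theorem curryLeft_wedge (σ : V →ₗ[ℝ] ℝ) (β : V [⋀^Fin (k + 1)]→ₗ[ℝ] N) (w : V) :
    (wedge σ β).curryLeft w = σ w • β - wedge σ (β.curryLeft w) := by
  ext X
  simp only [AlternatingMap.curryLeft_apply_apply, AlternatingMap.sub_apply,
    AlternatingMap.smul_apply, wedge_apply, Matrix.vecCons]
  rw [Fin.sum_univ_succ, sub_eq_add_neg, ← Finset.sum_neg_distrib]
  simp only [removeNth_zero_cons, removeNth_succ_cons, Fin.cons_zero, Fin.cons_succ, Fin.val_zero,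
    Fin.val_succ, pow_zero, one_smul, pow_succ, mul_neg, mul_one, neg_smul]

theorem curryLeft_wedge_zero (σ : V →ₗ[ℝ] ℝ) (β : V [⋀^Fin 0]→ₗ[ℝ] N) (w : V) :
    (wedge σ β).curryLeft w = σ w • β := by
  ext X
  simp only [AlternatingMap.curryLeft_apply_apply, AlternatingMap.smul_apply, wedge_apply,
    Matrix.vecCons]
  simp [Subsingleton.elim _ X]

theorem curryLeft_injective {β γ : V [⋀^Fin (k + 1)]→ₗ[ℝ] N}
    (h : ∀ w, β.curryLeft w = γ.curryLeft w) : β = γ := by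
  ext X
  rw [← Fin.cons_self_tail X]
  exact DFunLike.congr_fun (h (X 0)) (Fin.tail X)

theorem wedge_wedge (σ : V →ₗ[ℝ] ℝ) (β : V [⋀^Fin k]→ₗ[ℝ] N) : wedge σ (wedge σ β) = 0 := by
  induction k with
  | zero =>
    refine curryLeft_injective fun w => ?_
    rw [curryLeft_wedge, curryLeft_wedge_zero, map_smul, sub_self]; simp
  | succ k ih =>
    refine curryLeft_injective fun w => ?_
    rw [curryLeft_wedge, curryLeft_wedge, map_sub, map_smul, ih]; simp

theorem eq_zero_of_curryLeft {σ : V →ₗ[ℝ] ℝ} {v : V} (hv : σ v = 1)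
    {γ : V [⋀^Fin (k + 1)]→ₗ[ℝ] N} (h1 : γ.curryLeft v = 0)
    (h2 : ∀ w, σ w = 0 → γ.curryLeft w = 0) : γ = 0 := by
  refine curryLeft_injective fun w => ?_
  have h3 := h2 (w - σ w • v) (by simp [hv])
  rw [map_sub, map_smul, h1, smul_zero, sub_zero] at h3
  rw [h3]; simp

/-- A form vanishing on `ker σ` is divisible by `σ`. It suffices to compare contractions with `v`
and with `w ∈ ker σ`; the latter reduce to the same claim for the contraction of `β` by `w`, one
degree lower. -/
theorem wedge_curryLeft_of_forall_eq_zero {σ : V →ₗ[ℝ] ℝ} {v : V} (hv : σ v = 1)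
    {β : V [⋀^Fin (k + 1)]→ₗ[ℝ] N} (hβ : ∀ X, (∀ j, σ (X j) = 0) → β X = 0) :
    wedge σ (β.curryLeft v) = β := by
  rw [← sub_eq_zero]
  induction k with
  | zero =>
    have : ∀ w, (wedge σ (β.curryLeft v) - β).curryLeft w = σ w • β.curryLeft v - β.curryLeft w :=
      fun w => by
        rw [← curryLeft_wedge_zero]; rfl
    refine eq_zero_of_curryLeft hv ?_ fun w hw => ?_
    · rw [this, hv, one_smul, sub_self]
    · ext X
      rw [this, hw, zero_smul, zero_sub, AlternatingMap.neg_apply,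
        AlternatingMap.curryLeft_apply_apply, hβ _ fun j => ?_]
      · simp
      · refine Fin.cases hw (fun i => i.elim0) j
  | succ k ih =>
    have : ∀ w, (wedge σ (β.curryLeft v) - β).curryLeft w =
        σ w • β.curryLeft v - wedge σ ((β.curryLeft v).curryLeft w) - β.curryLeft w :=
      fun w => by
        rw [← curryLeft_wedge]; rfl
    refine eq_zero_of_curryLeft hv ?_ fun w hw => ?_
    · rw [this, hv, one_smul, AlternatingMap.curryLeft_same]; simp
    · have h1 : (β.curryLeft v).curryLeft w = -(β.curryLeft w).curryLeft v := by
        -- Polarizing the vanishing of the double contraction by `v + w` shows that contractions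
        -- anticommute.
        have h2 := β.curryLeft_same (v + w)
        simp only [map_add, AlternatingMap.curryLeft_add, LinearMap.add_apply,
          AlternatingMap.curryLeft_same, zero_add, add_zero] at h2
        exact eq_neg_of_add_eq_zero_right h2
      have h3 := ih (β := β.curryLeft w) (fun X hX => hβ _ fun j => by
        refine Fin.cases hw (fun i => hX i) j)
      rw [this, hw, zero_smul, zero_sub, h1, map_neg, neg_neg, h3]

theorem wedge_eq_zero {σ : V →ₗ[ℝ] ℝ} {v : V} (hv : σ v = 1)
    {β : V [⋀^Fin k]→ₗ[ℝ] N} (hβ : ∀ X, (∀ j, σ (X j) = 0) → β X = 0) :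
    wedge σ β = 0 := by
  cases k with
  | zero =>
    have : β = 0 := by ext X; exact hβ X fun j => j.elim0
    rw [this, map_zero]
  | succ k => rw [← wedge_curryLeft_of_forall_eq_zero hv hβ, wedge_wedge]

theorem wedge_apply_eq_zero (σ : V →ₗ[ℝ] ℝ) (β : V [⋀^Fin k]→ₗ[ℝ] N) {X : Fin (k + 1) → V}
    (hX : ∀ j, σ (X j) = 0) : wedge σ β X = 0 := by
  simp [wedge_apply, hX]

theorem wedge_apply_cons {σ : V →ₗ[ℝ] ℝ} {v : V} (hv : σ v = 1) (β : V [⋀^Fin k]→ₗ[ℝ] N)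
    {X : Fin k → V} (hX : ∀ j, σ (X j) = 0) : wedge σ β (Fin.cons v X) = β X := by
  rw [wedge_apply, Fin.sum_univ_succ]
  simp [hX, hv]

theorem wedge_compAlternatingMap {N' : Type*} [AddCommGroup N'] [Module ℝ N'] (f : N →ₗ[ℝ] N')
    (σ : V →ₗ[ℝ] ℝ) (β : V [⋀^Fin k]→ₗ[ℝ] N) :
    wedge σ (f.compAlternatingMap β) = f.compAlternatingMap (wedge σ β) := by
  ext X
  simp [wedge_apply]

end Wedge

/-- Evaluation of alternating maps at fixed arguments. -/
def evalAlternating {V N : Type*} [AddCommGroup V] [Module ℝ V] [AddCommGroup N] [Module ℝ N]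
    {b : ℕ} (Y : Fin b → V) : (V [⋀^Fin b]→ₗ[ℝ] N) →ₗ[ℝ] N where
  toFun β := β Y
  map_add' _ _ := rfl
  map_smul' _ _ := rfl

theorem alternating_sum_apply {V N ι : Type*} [AddCommGroup V] [Module ℝ V] [AddCommGroup N]
    [Module ℝ N] {b : ℕ} (s : Finset ι) (f : ι → V [⋀^Fin b]→ₗ[ℝ] N) (Y : Fin b → V) :
    (∑ i ∈ s, f i) Y = ∑ i ∈ s, f i Y :=
  map_sum (evalAlternating Y) f s

/-! ### Coordinate projections and the contracting homotopy. -/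

section Coordinates

variable {V : Type*} [AddCommGroup V] [Module ℝ V] {n : ℕ} (e : Basis (Fin n) ℝ V)

/-- The projection of `V` onto the `i`-th coordinate hyperplane along `e i`. -/
noncomputable def hyperplaneProj (i : Fin n) : V →ₗ[ℝ] V :=
  LinearMap.id - (e.coord i).smulRight (e i)

theorem hyperplaneProj_apply (i : Fin n) (v : V) :
    hyperplaneProj e i v = v - e.coord i v • e i := rfl

theorem hyperplaneProj_of_coord_eq_zero {i : Fin n} {v : V} (hv : e.coord i v = 0) :
    hyperplaneProj e i v = v := by
  rw [hyperplaneProj_apply, hv, zero_smul, sub_zero]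

theorem coord_self (i : Fin n) : e.coord i (e i) = 1 := by simp

theorem coord_ne {i j : Fin n} (h : i ≠ j) : e.coord i (e j) = 0 := by
  simp [h.symm]

theorem hyperplaneProj_self (i : Fin n) : hyperplaneProj e i (e i) = 0 := by
  rw [hyperplaneProj_apply, coord_self, one_smul, sub_self]

theorem hyperplaneProj_ne {i j : Fin n} (h : i ≠ j) : hyperplaneProj e i (e j) = e j :=
  hyperplaneProj_of_coord_eq_zero e (coord_ne e h)

theorem coord_hyperplaneProj {i j : Fin n} {v : V} (hv : e.coord i v = 0) :
    e.coord i (hyperplaneProj e j v) = 0 := by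
  rw [hyperplaneProj_apply, map_sub, map_smul, hv]
  by_cases h : i = j
  · subst h; simp [hv]
  · rw [coord_ne e h]; simp

/-- The projection of alternating forms onto the forms divisible by the `i`-th coordinate. -/
noncomputable def divisiblePart (b : ℕ) (i : Fin n) : End ℝ (V [⋀^Fin b]→ₗ[ℝ] ℝ) :=
  LinearMap.id -
    { toFun := fun β => β.compLinearMap (hyperplaneProj e i)
      map_add' := fun _ _ => rfl
      map_smul' := fun _ _ => rfl }

theorem divisiblePart_apply {b : ℕ} (i : Fin n) (β : V [⋀^Fin b]→ₗ[ℝ] ℝ) (Y : Fin b → V) :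
    divisiblePart e b i β Y = β Y - β fun j => hyperplaneProj e i (Y j) := rfl

/-- On `b` distinct basis vectors the `i`-th projection is the identity if `e i` occurs among them
and zero otherwise, so each component is counted `b` times. -/
theorem sum_divisiblePart {b : ℕ} (β : V [⋀^Fin b]→ₗ[ℝ] ℝ) :
    ∑ i, divisiblePart e b i β = (b : ℝ) • β := by
  refine e.ext_alternating fun v hv => ?_
  have h : ∀ i, divisiblePart e b i β (fun j => e (v j))
      = if i ∈ Finset.univ.image v then β (fun j => e (v j)) else 0 := fun i => by
    rw [divisiblePart_apply]
    split_ifs with hi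
    · obtain ⟨j, -, rfl⟩ := Finset.mem_image.1 hi
      rw [β.map_coord_zero (m := fun k => hyperplaneProj e (v j) (e (v k))) j
        (hyperplaneProj_self e _), sub_zero]
    · rw [sub_eq_zero]
      congr 1
      ext j
      rw [hyperplaneProj_ne]
      rintro rfl
      exact hi (Finset.mem_image_of_mem _ (Finset.mem_univ j))
  rw [alternating_sum_apply, Finset.sum_congr rfl fun i _ => h i, Finset.sum_ite_mem,
    Finset.univ_inter, Finset.sum_const, Finset.card_image_of_injective _ hv]
  simp

/-- The sum of the coordinates with respect to a basis. -/
noncomputable def coordSum : V →ₗ[ℝ] ℝ := ∑ i, e.coord i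

theorem coordSum_self (i : Fin n) : coordSum e (e i) = 1 := by
  rw [coordSum, LinearMap.sum_apply, Finset.sum_eq_single i fun j _ h => coord_ne e h]
  · exact coord_self e i
  · simp

/-- The homotopy contracting the complex given by the wedge product with `coordSum`. -/
noncomputable def homotopy {a b : ℕ} (ψ : V [⋀^Fin (a + 1)]→ₗ[ℝ] (V [⋀^Fin b]→ₗ[ℝ] ℝ)) :
    V [⋀^Fin a]→ₗ[ℝ] (V [⋀^Fin b]→ₗ[ℝ] ℝ) :=
  ∑ i, (divisiblePart e b i).compAlternatingMap (ψ.curryLeft (e i))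

theorem homotopy_apply {a b : ℕ} (ψ : V [⋀^Fin (a + 1)]→ₗ[ℝ] (V [⋀^Fin b]→ₗ[ℝ] ℝ))
    (X : Fin a → V) (Y : Fin b → V) :
    homotopy e ψ X Y = ∑ i, (ψ (Fin.cons (e i) X) Y
      - ψ (Fin.cons (e i) X) fun j => hyperplaneProj e i (Y j)) := by
  rw [homotopy, alternating_sum_apply, alternating_sum_apply]
  rfl

/-- Because `σ (e i) = 1`, every contraction of `ψ` by some `e i` is a preimage of `ψ` under `σ ∧
·`. Weighting these preimages by the projections acting on the right arguments, whose sum is `b`,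
still gives a preimage of `b • ψ`. -/
theorem wedge_homotopy {a b : ℕ} {ψ : V [⋀^Fin (a + 1)]→ₗ[ℝ] (V [⋀^Fin b]→ₗ[ℝ] ℝ)}
    (hψ : wedge (coordSum e) ψ = 0) : wedge (coordSum e) (homotopy e ψ) = (b : ℝ) • ψ := by
  have h : ∀ i, wedge (coordSum e) (ψ.curryLeft (e i)) = ψ := fun i => by
    have h1 := curryLeft_wedge (coordSum e) ψ (e i)
    rw [hψ, coordSum_self, one_smul] at h1
    exact (sub_eq_zero.1 h1.symm).symm
  rw [homotopy, map_sum]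
  simp only [wedge_compAlternatingMap, h]
  ext1 X
  rw [alternating_sum_apply]
  exact sum_divisiblePart e (ψ X)

end Coordinates

/-! ### Vanishing conditions and the exact sequence of multiplication by `σ`. -/

section Vanishing

variable {V : Type*} [AddCommGroup V] [Module ℝ V] {n a b : ℕ}

/-- The double covectors that vanish when all left arguments are in `S` and all right ones
in `T`. -/
def vanishOn (S T : Set V) (a b : ℕ) : Submodule ℝ (DoubleCovector V a b) where
  carrier := {φ | ∀ X Y, (∀ j, X j ∈ S) → (∀ j, Y j ∈ T) → φ X Y = 0}
  add_mem' hφ hψ X Y hX hY := by simp [hφ X Y hX hY, hψ X Y hX hY]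
  zero_mem' X Y hX hY := by simp
  smul_mem' c φ hφ X Y hX hY := by simp [hφ X Y hX hY]

theorem vanishOn_anti {S S' T T' : Set V} (hS : S ⊆ S') (hT : T ⊆ T') :
    vanishOn S' T' a b ≤ vanishOn S T a b :=
  fun _ hφ X Y hX hY => hφ X Y (fun j => hS (hX j)) fun j => hT (hY j)

/-- The double covectors with vanishing restrictions to all coordinate hyperplanes. -/
noncomputable def coordVanishing (e : Basis (Fin n) ℝ V) (a b : ℕ) :
    Submodule ℝ (DoubleCovector V a b) :=
  ⨅ i, vanishOn {v | e.coord i v = 0} {v | e.coord i v = 0} a b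

/-- The null vectors of `coordSum`. -/
def coordSumNull (e : Basis (Fin n) ℝ V) : Set V := {v | coordSum e v = 0}

/-- The elements of `coordVanishing` divisible by `coordSum` on the left. -/
noncomputable def leftDivisible (e : Basis (Fin n) ℝ V) (a b : ℕ) :
    Submodule ℝ (DoubleCovector V a b) :=
  coordVanishing e a b ⊓ vanishOn (coordSumNull e) Set.univ a b

/-- The wedge product with a covector on the left. -/
noncomputable def leftWedge (σ : V →ₗ[ℝ] ℝ) (a b : ℕ) :
    DoubleCovector V a b →ₗ[ℝ] DoubleCovector V (a + 1) b :=
  (DoubleCovector.toAlternating V (a + 1) b).symm.toLinearMap ∘ₗ wedge σ ∘ₗ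
    (DoubleCovector.toAlternating V a b).toLinearMap

theorem leftWedge_apply (σ : V →ₗ[ℝ] ℝ) (φ : DoubleCovector V a b) (X : Fin (a + 1) → V)
    (Y : Fin b → V) : leftWedge σ a b φ X Y
      = ∑ k : Fin (a + 1), (-1 : ℝ) ^ (k : ℕ) * (σ (X k) * φ (k.removeNth X) Y) := by
  change evalAlternating Y (wedge σ (DoubleCovector.toAlternating V a b φ) X) = _
  rw [wedge_apply, map_sum]
  rfl

theorem leftWedge_eq_zero {σ : V →ₗ[ℝ] ℝ} {v : V} (hv : σ v = 1) {φ : DoubleCovector V a b}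
    (hφ : φ ∈ vanishOn {v | σ v = 0} Set.univ a b) : leftWedge σ a b φ = 0 :=
  wedge_eq_zero (β := DoubleCovector.toAlternating V a b φ) hv fun X hX =>
    AlternatingMap.ext fun Y => hφ X Y hX fun _ => trivial

theorem leftWedge_mem_vanishOn {σ : V →ₗ[ℝ] ℝ} {v : V} (hv : σ v = 1) {T : Set V}
    {φ : DoubleCovector V a b} (hφ : φ ∈ vanishOn {v | σ v = 0} T a b) :
    leftWedge σ a b φ ∈ vanishOn Set.univ T (a + 1) b := by
  intro X Y _ hY
  have h := wedge_eq_zero hv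
    (β := (evalAlternating Y).compAlternatingMap (DoubleCovector.toAlternating V a b φ))
    fun X hX => hφ X Y hX hY
  rw [wedge_compAlternatingMap] at h
  exact DFunLike.congr_fun h X

theorem leftWedge_mem_vanishOn_null (σ : V →ₗ[ℝ] ℝ) (φ : DoubleCovector V a b) :
    leftWedge σ a b φ ∈ vanishOn {v | σ v = 0} Set.univ (a + 1) b :=
  fun _ Y hX _ => DFunLike.congr_fun
    (wedge_apply_eq_zero σ (DoubleCovector.toAlternating V a b φ) hX) Y

theorem mem_vanishOn_of_leftWedge_mem {σ : V →ₗ[ℝ] ℝ} {v : V} (hv : σ v = 1) {T : Set V}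
    {φ : DoubleCovector V a b} (hφ : leftWedge σ a b φ ∈ vanishOn Set.univ T (a + 1) b) :
    φ ∈ vanishOn {v | σ v = 0} T a b := by
  intro X Y hX hY
  rw [← hφ (Fin.cons v X) Y (fun _ => trivial) hY]
  exact (DFunLike.congr_fun
    (wedge_apply_cons hv (DoubleCovector.toAlternating V a b φ) hX) Y).symm

theorem leftWedge_mem_coordVanishing (e : Basis (Fin n) ℝ V) (σ : V →ₗ[ℝ] ℝ)
    {φ : DoubleCovector V a b} (hφ : φ ∈ coordVanishing e a b) :
    leftWedge σ a b φ ∈ coordVanishing e (a + 1) b := by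
  rw [coordVanishing, Submodule.mem_iInf] at hφ ⊢
  intro i X Y hX hY
  rw [leftWedge_apply]
  refine Finset.sum_eq_zero fun k _ => ?_
  rw [hφ i (k.removeNth X) Y (fun j => hX _) hY, mul_zero, mul_zero]

/-- This is what the projections in the homotopy are for. On the `i`-th hyperplane, the summands `k
≠ i` vanish since `e k` lies in that hyperplane and the `k`-th projection preserves it; the summand
`k = i` vanishes since the `i`-th projection fixes the right arguments. -/
theorem homotopy_mem_coordVanishing (e : Basis (Fin n) ℝ V) {ψ : DoubleCovector V (a + 1) b}
    (hψ : ψ ∈ coordVanishing e (a + 1) b) :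
    (DoubleCovector.toAlternating V a b).symm
      (homotopy e (DoubleCovector.toAlternating V (a + 1) b ψ)) ∈ coordVanishing e a b := by
  rw [coordVanishing, Submodule.mem_iInf] at hψ ⊢
  intro i X Y hX hY
  refine (homotopy_apply e (DoubleCovector.toAlternating V (a + 1) b ψ) X Y).trans ?_
  refine Finset.sum_eq_zero fun k _ => ?_
  by_cases h : i = k
  · subst h
    rw [sub_eq_zero]
    congr 1
    ext j
    exact (hyperplaneProj_of_coord_eq_zero e (hY j)).symm
  · have hX' : ∀ j, (Fin.cons (e k) X : Fin (a + 1) → V) j ∈ {v | e.coord i v = 0} :=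
      Fin.cases (coord_ne e h) hX
    have h1 := hψ i _ Y hX' hY
    have h2 := hψ i _ (fun j => hyperplaneProj e k (Y j)) hX'
      fun j => coord_hyperplaneProj e (hY j)
    change ψ _ _ - ψ _ _ = 0
    rw [h1, h2, sub_zero]

/-- Rank-nullity for `σ ∧ ·` on the left, whose kernel consists of the left multiples of `σ`. The
homotopy gives preimages up to the factor `b + 1`, which is why at least one right argument is
needed. The set `T` is kept free: `ker σ` on the right yields the bubbles, the empty set removes the
condition. -/
theorem finrank_leftDivisible_add [∀ a b, Module.Finite ℝ (DoubleCovector V a b)]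
    (e : Basis (Fin (n + 1)) ℝ V) (a b : ℕ) (T : Set V) :
    finrank ℝ (leftDivisible e a (b + 1))
      + finrank ℝ ↥(leftDivisible e (a + 1) (b + 1) ⊓ vanishOn Set.univ T (a + 1) (b + 1))
      = finrank ℝ ↥(coordVanishing e a (b + 1) ⊓ vanishOn (coordSumNull e) T a (b + 1)) := by
  set σ := coordSum e with hσ
  have hv : σ (e 0) = 1 := coordSum_self e 0
  let S : ↥(coordVanishing e a (b + 1) ⊓ vanishOn (coordSumNull e) T a (b + 1)) →ₗ[ℝ]
      ↥(leftDivisible e (a + 1) (b + 1) ⊓ vanishOn Set.univ T (a + 1) (b + 1)) :=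
    (leftWedge σ a (b + 1)).restrict fun φ hφ =>
      ⟨⟨leftWedge_mem_coordVanishing e σ hφ.1, leftWedge_mem_vanishOn_null σ φ⟩,
        leftWedge_mem_vanishOn hv hφ.2⟩
  have hsurj : Function.Surjective S := by
    rintro ⟨ψ, ⟨⟨h1, h2⟩, h3⟩⟩
    set η : DoubleCovector V a (b + 1) := (DoubleCovector.toAlternating V a (b + 1)).symm
      (homotopy e (DoubleCovector.toAlternating V (a + 1) (b + 1) ψ)) with hη
    have hw : leftWedge σ a (b + 1) η = ((b + 1 : ℕ) : ℝ) • ψ :=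
      wedge_homotopy e (ψ := DoubleCovector.toAlternating V (a + 1) (b + 1) ψ)
        (leftWedge_eq_zero hv h2)
    have hηT : η ∈ vanishOn (coordSumNull e) T a (b + 1) := by
      refine mem_vanishOn_of_leftWedge_mem hv ?_
      rw [hw]
      exact Submodule.smul_mem _ _ h3
    refine ⟨(((b + 1 : ℕ) : ℝ)⁻¹) • ⟨η, homotopy_mem_coordVanishing e h1, hηT⟩, ?_⟩
    rw [map_smul]
    refine Subtype.ext ?_
    change (((b + 1 : ℕ) : ℝ)⁻¹) • leftWedge σ a (b + 1) η = ψ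
    rw [hw, inv_smul_smul₀ (by positivity)]
  have hker : (LinearMap.ker S).map (Submodule.subtype _) = leftDivisible e a (b + 1) := by
    ext φ
    constructor
    · rintro ⟨⟨ψ, hψ⟩, h, rfl⟩
      refine ⟨hψ.1, mem_vanishOn_of_leftWedge_mem hv ?_⟩
      have h' : leftWedge σ a (b + 1) ψ = 0 := congrArg Subtype.val h
      rw [Submodule.subtype_apply, h']
      exact Submodule.zero_mem _
    · intro h
      exact ⟨⟨φ, h.1, vanishOn_anti subset_rfl (Set.subset_univ T) h.2⟩,
        Subtype.ext (leftWedge_eq_zero hv h.2), rfl⟩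
  rw [← hker, Submodule.finrank_map_subtype_eq, ← LinearMap.finrank_range_add_finrank_ker S,
    LinearMap.range_eq_top.2 hsurj, finrank_top, add_comm]

end Vanishing

/-! ### Components in a basis and the count of covering pairs. -/

section Components

variable {V : Type*} [AddCommGroup V] [Module ℝ V] {n : ℕ}

/-- The vectors of a basis indexed by a finite set of indices, in increasing order. -/
noncomputable def basisTuple (e : Basis (Fin n) ℝ V) {k : ℕ} (s : Set.powersetCard (Fin n) k) :
    Fin k → V :=
  e ∘ Set.powersetCard.ofFinEmbEquiv.symm s

theorem exists_basisTuple_eq (e : Basis (Fin n) ℝ V) {k : ℕ} {s : Set.powersetCard (Fin n) k}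
    {i : Fin n} (hi : i ∈ s) : ∃ j, basisTuple e s j = e i := by
  obtain ⟨j, hj⟩ := (Set.powersetCard.mem_range_ofFinEmbEquiv_symm_iff_mem s i).2 hi
  exact ⟨j, congrArg e hj⟩

theorem coord_basisTuple (e : Basis (Fin n) ℝ V) {k : ℕ} {s : Set.powersetCard (Fin n) k}
    {i : Fin n} (hi : i ∉ s) (j : Fin k) : e.coord i (basisTuple e s j) = 0 := by
  refine coord_ne e ?_
  rintro rfl
  exact hi ((Set.powersetCard.mem_range_ofFinEmbEquiv_symm_iff_mem s _).1 ⟨j, rfl⟩)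

/-- The components of an alternating map with respect to a basis. -/
noncomputable def alternatingComponents (e : Basis (Fin n) ℝ V) (N : Type*) [AddCommGroup N]
    [Module ℝ N] (k : ℕ) :
    (V [⋀^Fin k]→ₗ[ℝ] N) ≃ₗ[ℝ] (Set.powersetCard (Fin n) k → N) :=
  exteriorPower.alternatingMapLinearEquiv ≪≫ₗ ((e.exteriorPower k).constr ℝ).symm

theorem alternatingComponents_apply (e : Basis (Fin n) ℝ V) {N : Type*} [AddCommGroup N]
    [Module ℝ N] {k : ℕ} (β : V [⋀^Fin k]→ₗ[ℝ] N) (s : Set.powersetCard (Fin n) k) :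
    alternatingComponents e N k β s = β (basisTuple e s) := by
  change exteriorPower.alternatingMapLinearEquiv β (e.exteriorPower k s) = _
  rw [exteriorPower.basis_apply, exteriorPower.ιMulti_family,
    exteriorPower.alternatingMapLinearEquiv_apply_ιMulti]
  rfl

/-- The components of a double covector with respect to a basis. -/
noncomputable def components (e : Basis (Fin n) ℝ V) (a b : ℕ) :
    DoubleCovector V a b ≃ₗ[ℝ]
      (Set.powersetCard (Fin n) a → Set.powersetCard (Fin n) b → ℝ) :=
  DoubleCovector.toAlternating V a b ≪≫ₗ alternatingComponents e _ a ≪≫ₗ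
    LinearEquiv.piCongrRight fun _ => alternatingComponents e ℝ b

theorem components_apply (e : Basis (Fin n) ℝ V) {a b : ℕ} (φ : DoubleCovector V a b)
    (s : Set.powersetCard (Fin n) a) (t : Set.powersetCard (Fin n) b) :
    components e a b φ s t = φ (basisTuple e s) (basisTuple e t) := by
  change alternatingComponents e ℝ b (alternatingComponents e _ a
    (DoubleCovector.toAlternating V a b φ) s) t = _
  rw [alternatingComponents_apply, alternatingComponents_apply]
  rfl

theorem finite_doubleCovector (e : Basis (Fin n) ℝ V) (a b : ℕ) :
    Module.Finite ℝ (DoubleCovector V a b) :=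
  Module.Finite.equiv (components e a b).symm

/-- The pairs of index sets that cover all indices. -/
abbrev CoveringPairs (n a b : ℕ) : Type :=
  {x : Set.powersetCard (Fin n) a × Set.powersetCard (Fin n) b // ∀ i, i ∈ x.1 ∨ i ∈ x.2}

theorem components_eq_zero_of_mem_coordVanishing (e : Basis (Fin n) ℝ V) {a b : ℕ}
    {φ : DoubleCovector V a b} (hφ : φ ∈ coordVanishing e a b) {s : Set.powersetCard (Fin n) a}
    {t : Set.powersetCard (Fin n) b} (h : ¬ ∀ i, i ∈ s ∨ i ∈ t) : components e a b φ s t = 0 := by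
  push Not at h
  obtain ⟨i, hs, ht⟩ := h
  rw [components_apply]
  exact (Submodule.mem_iInf _).1 hφ i _ _ (coord_basisTuple e hs) (coord_basisTuple e ht)

/-- Pullback of a double covector along an endomorphism. -/
noncomputable def pullback {a b : ℕ} (f : V →ₗ[ℝ] V) (φ : DoubleCovector V a b) :
    DoubleCovector V a b :=
  (DoubleCovector.toAlternating V a b).symm
    (LinearMap.compAlternatingMap
      { toFun := fun β : V [⋀^Fin b]→ₗ[ℝ] ℝ => β.compLinearMap f
        map_add' := fun _ _ => rfl
        map_smul' := fun _ _ => rfl }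
      ((DoubleCovector.toAlternating V a b φ).compLinearMap f))

theorem pullback_apply {a b : ℕ} (f : V →ₗ[ℝ] V) (φ : DoubleCovector V a b) (X : Fin a → V)
    (Y : Fin b → V) : pullback f φ X Y = φ (f ∘ X) (f ∘ Y) := rfl

/-- Restriction to the `i`-th hyperplane is captured by pulling back along the projection killing `e
i`. Components of the pullback whose index sets contain `i` vanish, and the others belong to pairs
not covering `i`. -/
theorem mem_coordVanishing_of_components (e : Basis (Fin n) ℝ V) {a b : ℕ}
    {φ : DoubleCovector V a b}
    (h : ∀ s t, (¬ ∀ i, i ∈ s ∨ i ∈ t) → components e a b φ s t = 0) :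
    φ ∈ coordVanishing e a b := by
  refine (Submodule.mem_iInf _).2 fun i X Y hX hY => ?_
  have hX' : hyperplaneProj e i ∘ X = X :=
    funext fun j => hyperplaneProj_of_coord_eq_zero e (hX j)
  have hY' : hyperplaneProj e i ∘ Y = Y :=
    funext fun j => hyperplaneProj_of_coord_eq_zero e (hY j)
  have hφ : pullback (hyperplaneProj e i) φ = 0 := by
    refine (components e a b).map_eq_zero_iff.1 (funext fun s => funext fun t => ?_)
    rw [components_apply, pullback_apply]
    by_cases hs : i ∈ s
    · obtain ⟨j, hj⟩ := exists_basisTuple_eq e hs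
      have : φ (hyperplaneProj e i ∘ basisTuple e s) = 0 :=
        (DoubleCovector.toAlternating V a b φ).map_coord_zero j
          (by rw [Function.comp_apply, hj, hyperplaneProj_self])
      rw [this]; rfl
    by_cases ht : i ∈ t
    · obtain ⟨j, hj⟩ := exists_basisTuple_eq e ht
      exact (φ _).map_coord_zero j (by rw [Function.comp_apply, hj, hyperplaneProj_self])
    have h1 : hyperplaneProj e i ∘ basisTuple e s = basisTuple e s :=
      funext fun j => hyperplaneProj_of_coord_eq_zero e (coord_basisTuple e hs j)
    have h2 : hyperplaneProj e i ∘ basisTuple e t = basisTuple e t :=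
      funext fun j => hyperplaneProj_of_coord_eq_zero e (coord_basisTuple e ht j)
    rw [h1, h2, ← components_apply]
    exact h s t fun h3 => (h3 i).elim hs ht
  rw [← hX', ← hY', ← pullback_apply, hφ]
  rfl

open Classical in
theorem finrank_coordVanishing_eq_card (e : Basis (Fin n) ℝ V) (a b : ℕ) :
    finrank ℝ (coordVanishing e a b) = Nat.card (CoveringPairs n a b) := by
  let F : coordVanishing e a b →ₗ[ℝ] (CoveringPairs n a b → ℝ) :=
    { toFun := fun φ x => components e a b φ x.1.1 x.1.2
      map_add' := fun φ ψ => by ext x; simp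
      map_smul' := fun c φ => by ext x; simp }
  have hF : Function.Bijective F := by
    constructor
    · refine (injective_iff_map_eq_zero F).2 fun φ hφ => Subtype.ext ?_
      refine (components e a b).map_eq_zero_iff.1 (funext fun s => funext fun t => ?_)
      by_cases h : ∀ i, i ∈ s ∨ i ∈ t
      · exact congrFun hφ ⟨(s, t), h⟩
      · exact components_eq_zero_of_mem_coordVanishing e φ.2 h
    · intro f
      refine ⟨⟨(components e a b).symm fun s t =>
        if h : ∀ i, i ∈ s ∨ i ∈ t then f ⟨(s, t), h⟩ else 0, ?_⟩, ?_⟩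
      · refine mem_coordVanishing_of_components e fun s t h => ?_
        rw [LinearEquiv.apply_symm_apply, dif_neg h]
      · ext ⟨⟨s, t⟩, h⟩
        change components e a b _ s t = _
        rw [LinearEquiv.apply_symm_apply, dif_pos h]
  rw [(LinearEquiv.ofBijective F hF).finrank_eq, Module.finrank_fintype_fun_eq_card,
    Nat.card_eq_fintype_card]

/-- A covering pair is determined by its second set and the complement of its first one. -/
def coveringPairsEquiv {n a c : ℕ} (b : ℕ) (h : a + c = n) : CoveringPairs n a b ≃
    {x // x ∈ ((Finset.univ : Finset (Fin n)).powersetCard b).sigma fun t => t.powersetCard c} where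
  toFun x := ⟨⟨x.1.2.1, x.1.1.1ᶜ⟩, by
    have h1 : x.1.1.1.card = a := x.1.1.2
    have h2 : x.1.2.1.card = b := x.1.2.2
    simp only [Finset.mem_sigma, Finset.mem_powersetCard, Finset.subset_univ, true_and, h2,
      Finset.card_compl, Fintype.card_fin, h1]
    refine ⟨fun i hi => ?_, by omega⟩
    exact (x.2 i).resolve_left (Finset.mem_compl.1 hi)⟩
  invFun y := ⟨(⟨y.1.2ᶜ, by
    have h1 := (Finset.mem_powersetCard.1 (Finset.mem_sigma.1 y.2).2).2
    change (y.1.2ᶜ).card = a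
    rw [Finset.card_compl, h1, Fintype.card_fin]
    omega⟩, ⟨y.1.1, (Finset.mem_powersetCard.1 (Finset.mem_sigma.1 y.2).1).2⟩), fun i => by
      by_cases hi : i ∈ y.1.2
      · exact Or.inr ((Finset.mem_powersetCard.1 (Finset.mem_sigma.1 y.2).2).1 hi)
      · exact Or.inl (Finset.mem_compl.2 hi)⟩
  left_inv x := by
    refine Subtype.ext (Prod.ext (Subtype.ext ?_) (Subtype.ext ?_)) <;> simp
  right_inv y := by
    refine Subtype.ext ?_
    simp

theorem finrank_coordVanishing (e : Basis (Fin n) ℝ V) {a c : ℕ} (b : ℕ) (h : a + c = n) :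
    finrank ℝ (coordVanishing e a b) = n.choose b * b.choose c := by
  rw [finrank_coordVanishing_eq_card, Nat.card_congr (coveringPairsEquiv b h),
    Nat.card_eq_fintype_card, Fintype.card_coe, Finset.card_sigma]
  rw [Finset.sum_congr rfl fun t ht => by
    rw [Finset.card_powersetCard, (Finset.mem_powersetCard.1 ht).2]]
  simp

theorem doubleCovector_eq_zero_of_lt_left (e : Basis (Fin n) ℝ V) {a b : ℕ} (h : n < a)
    (φ : DoubleCovector V a b) : φ = 0 := by
  refine (components e a b).map_eq_zero_iff.1 (funext fun s => ?_)
  have h1 : s.1.card = a := s.2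
  have h2 := Finset.card_le_univ s.1
  rw [Fintype.card_fin] at h2
  omega

end Components

/-! ### Dimensions of the divisible covectors and differences of bubble dimensions. -/

section Dimensions

variable {V : Type*} [AddCommGroup V] [Module ℝ V] {n : ℕ}

theorem finrank_leftDivisible_of_lt (e : Basis (Fin n) ℝ V) {a b : ℕ} (h : n < a) :
    finrank ℝ (leftDivisible e a b) = 0 := by
  have : leftDivisible e a b = ⊥ :=
    (Submodule.eq_bot_iff _).2 fun φ _ => doubleCovector_eq_zero_of_lt_left e h φ
  rw [this, finrank_bot]

theorem leftDivisible_zero (e : Basis (Fin n) ℝ V) (b : ℕ) : leftDivisible e 0 b = ⊥ :=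
  (Submodule.eq_bot_iff _).2 fun _ hφ => DoubleCovector.ext fun X Y =>
    hφ.2 X Y (fun j => j.elim0) fun _ => trivial

theorem finrank_leftDivisible (e : Basis (Fin (n + 1)) ℝ V) (b : ℕ) {a : ℕ} :
    ∀ {c : ℕ}, a + c = n + 1 →
      finrank ℝ (leftDivisible e a (b + 1)) = (n + 1).choose (b + 1) * b.choose c := by
  have := finite_doubleCovector e
  induction a with
  | zero =>
    intro c hc
    rw [leftDivisible_zero, finrank_bot]
    -- Here `c = n + 1`, so one of the two binomial coefficients on the right vanishes.
    rcases lt_or_ge b c with h | h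
    · rw [Nat.choose_eq_zero_of_lt h, mul_zero]
    · rw [Nat.choose_eq_zero_of_lt (show n + 1 < b + 1 by omega), zero_mul]
  | succ a ih =>
    intro c hc
    have h1 := finrank_leftDivisible_add e a b ∅
    -- With `b + 1 > 0` right arguments and `T = ∅` the vanishing condition is void.
    have h2 : ∀ (S : Set V) (k : ℕ), vanishOn S ∅ k (b + 1) = ⊤ := fun S k =>
      (Submodule.eq_top_iff').2 fun φ X Y _ hY => (hY 0).elim
    rw [h2, h2, inf_top_eq, inf_top_eq, ih (show a + (c + 1) = n + 1 by omega),
      finrank_coordVanishing e (b + 1) (show a + (c + 1) = n + 1 by omega),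
      Nat.choose_succ_succ' b c] at h1
    rw [mul_add] at h1
    omega

/-- Exchanging the left and the right arguments of a double covector. -/
noncomputable def swap (V : Type*) [AddCommGroup V] [Module ℝ V] (a b : ℕ) :
    DoubleCovector V a b →ₗ[ℝ] DoubleCovector V b a where
  toFun φ := (DoubleCovector.toAlternating V b a).symm
    { toFun := fun Y =>
        (evalAlternating Y).compAlternatingMap (DoubleCovector.toAlternating V a b φ)
      map_update_add' := fun Y i x y => by ext X; exact (φ X).map_update_add Y i x y
      map_update_smul' := fun Y i c x => by ext X; exact (φ X).map_update_smul Y i c x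
      map_eq_zero_of_eq' := fun Y i j h hij => by
        ext X; exact (φ X).map_eq_zero_of_eq Y h hij }
  map_add' _ _ := rfl
  map_smul' _ _ := rfl

theorem swap_mem_vanishOn {S T : Set V} {a b : ℕ} {φ : DoubleCovector V a b}
    (h : φ ∈ vanishOn S T a b) : swap V a b φ ∈ vanishOn T S b a :=
  fun X Y hX hY => h Y X hY hX

theorem swap_mem_coordVanishing (e : Basis (Fin n) ℝ V) {a b : ℕ} {φ : DoubleCovector V a b}
    (h : φ ∈ coordVanishing e a b) : swap V a b φ ∈ coordVanishing e b a :=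
  (Submodule.mem_iInf _).2 fun i => swap_mem_vanishOn ((Submodule.mem_iInf _).1 h i)

theorem finrank_eq_of_swap {a b : ℕ} {A : Submodule ℝ (DoubleCovector V a b)}
    {B : Submodule ℝ (DoubleCovector V b a)} (hAB : ∀ φ ∈ A, swap V a b φ ∈ B)
    (hBA : ∀ φ ∈ B, swap V b a φ ∈ A) : finrank ℝ A = finrank ℝ B :=
  LinearEquiv.finrank_eq (LinearEquiv.ofBijective ((swap V a b).restrict hAB)
    ⟨fun _ _ h => Subtype.ext (congrArg (swap V b a) (congrArg Subtype.val h)),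
      fun ψ => ⟨⟨swap V b a ψ, hBA ψ ψ.2⟩, rfl⟩⟩)

/-- The double covectors with vanishing restrictions to all coordinate hyperplanes and to the
hyperplane of vectors with coordinate sum zero. -/
noncomputable def bubbles (e : Basis (Fin n) ℝ V) (a b : ℕ) : Submodule ℝ (DoubleCovector V a b) :=
  coordVanishing e a b ⊓ vanishOn (coordSumNull e) (coordSumNull e) a b

theorem finrank_bubbles_swap (e : Basis (Fin n) ℝ V) (a b : ℕ) :
    finrank ℝ (bubbles e a b) = finrank ℝ (bubbles e b a) :=
  finrank_eq_of_swap
    (fun _ h => ⟨swap_mem_coordVanishing e h.1, swap_mem_vanishOn h.2⟩)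
    (fun _ h => ⟨swap_mem_coordVanishing e h.1, swap_mem_vanishOn h.2⟩)

/-- The exact sequences in bidegrees `(a, b + 1)` and `(b, a + 1)` end in covectors divisible by `σ`
on both sides, in bidegrees exchanged by the swap. Those terms cancel, so their dimension is never
computed. -/
theorem finrank_bubbles_add (e : Basis (Fin (n + 1)) ℝ V) (a b : ℕ) :
    finrank ℝ (bubbles e a (b + 1)) + finrank ℝ (leftDivisible e b (a + 1))
      = finrank ℝ (bubbles e (a + 1) b) + finrank ℝ (leftDivisible e a (b + 1)) := by
  have := finite_doubleCovector e
  have h1 := finrank_leftDivisible_add e a b (coordSumNull e)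
  have h2 := finrank_leftDivisible_add e b a (coordSumNull e)
  rw [← bubbles] at h1 h2
  rw [finrank_bubbles_swap e b (a + 1)] at h2
  have h3 : finrank ℝ ↥(leftDivisible e (a + 1) (b + 1)
        ⊓ vanishOn Set.univ (coordSumNull e) (a + 1) (b + 1))
      = finrank ℝ ↥(leftDivisible e (b + 1) (a + 1)
        ⊓ vanishOn Set.univ (coordSumNull e) (b + 1) (a + 1)) :=
    finrank_eq_of_swap
      (fun _ h => ⟨⟨swap_mem_coordVanishing e h.1.1, swap_mem_vanishOn h.2⟩,
        swap_mem_vanishOn h.1.2⟩)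
      (fun _ h => ⟨⟨swap_mem_coordVanishing e h.1.1, swap_mem_vanishOn h.2⟩,
        swap_mem_vanishOn h.1.2⟩)
  omega

end Dimensions

/-! ### Bubbles on the simplex and constant fields. -/

section Simplex

/-- The last `n` barycentric coordinates identify the tangent space of `T^n` with `ℝ^n`. -/
noncomputable def simplexTangentEquiv (n : ℕ) : simplexTangent n ≃ₗ[ℝ] (Fin n → ℝ) where
  toFun v i := (v : Fin (n + 1) → ℝ) i.succ
  map_add' _ _ := rfl
  map_smul' _ _ := rfl
  invFun w := ⟨Fin.cons (-∑ i, w i) w, by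
    change ∑ i, _ = (0 : ℝ)
    rw [Fin.sum_univ_succ]; simp⟩
  left_inv v := by
    refine Subtype.ext (funext fun i => ?_)
    have h : ∑ i, (v : Fin (n + 1) → ℝ) i = 0 := v.2
    rw [Fin.sum_univ_succ] at h
    refine Fin.cases ?_ (fun j => rfl) i
    exact (eq_neg_of_add_eq_zero_left h).symm
  right_inv w := by ext i; simp

/-- The basis of the tangent space of `T^n` dual to the last `n` barycentric coordinates. -/
noncomputable def simplexBasis (n : ℕ) : Basis (Fin n) ℝ (simplexTangent n) :=
  Basis.ofEquivFun (simplexTangentEquiv n)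

theorem simplexBasis_coord {n : ℕ} (i : Fin n) (v : simplexTangent n) :
    (simplexBasis n).coord i v = (v : Fin (n + 1) → ℝ) i.succ := by
  rw [Basis.coord_apply, simplexBasis, Basis.ofEquivFun_repr_apply]; rfl

theorem coordSum_simplexBasis {n : ℕ} (v : simplexTangent n) :
    coordSum (simplexBasis n) v = -(v : Fin (n + 1) → ℝ) 0 := by
  have h : ∑ i, (v : Fin (n + 1) → ℝ) i = 0 := v.2
  rw [Fin.sum_univ_succ] at h
  rw [coordSum, LinearMap.sum_apply]
  simp only [simplexBasis_coord]
  linarith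

/-- The tangent vectors of `T^n` that are tangent to the `i`-th facet. -/
def facetTangent {n : ℕ} (i : Fin (n + 1)) : Set (simplexTangent n) :=
  {v | (v : Fin (n + 1) → ℝ) i = 0}

/-- The covectors on the tangent space of `T^n` with vanishing restrictions to all facets. -/
noncomputable def traceFree (n p q : ℕ) : Submodule ℝ (DoubleCovector (simplexTangent n) p q) :=
  ⨅ i, vanishOn (facetTangent i) (facetTangent i) p q

/-- The facets `λ_1 = 0, …, λ_n = 0` give the coordinate hyperplanes, and `λ_0 = 0` gives the null
hyperplane of the coordinate sum. -/
theorem traceFree_eq_bubbles (n p q : ℕ) : traceFree n p q = bubbles (simplexBasis n) p q := by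
  have h0 : coordSumNull (simplexBasis n) = facetTangent 0 := by
    ext v
    rw [coordSumNull, Set.mem_ofPred_eq, coordSum_simplexBasis, neg_eq_zero]
    rfl
  ext φ
  simp only [traceFree, bubbles, coordVanishing, Submodule.mem_inf, Submodule.mem_iInf, h0,
    simplexBasis_coord]
  exact ⟨fun h => ⟨fun i => h i.succ, h 0⟩, fun h => Fin.cases h.2 h.1⟩

theorem bianchiStable_traceFree (n : ℕ) : BianchiStable (traceFree n) where
  bianchi_mem {p q φ} h := by
    refine (Submodule.mem_iInf _).2 fun i X Y hX hY => ?_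
    rw [bianchi_apply]
    refine Finset.sum_eq_zero fun a _ => ?_
    rw [(Submodule.mem_iInf _).1 h i (a.removeNth X) _ (fun j => hX _) (Fin.cases (hX a) hY),
      mul_zero]
  bianchiStar_mem {p q φ} h := by
    refine (Submodule.mem_iInf _).2 fun i X Y hX hY => ?_
    rw [bianchiStar_apply]
    refine Finset.sum_eq_zero fun a _ => ?_
    rw [(Submodule.mem_iInf _).1 h i _ (a.removeNth Y) (Fin.cases (hY a) hX) (fun j => hY _),
      mul_zero]

theorem finrank_traceFree_inf_summand_add (n m : ℕ) {p q P Q : ℕ} (hP : P = p + m)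
    (hq : q = Q + 1 + m) (hQ : Q + 1 ≤ p) :
    finrank ℝ ↥(traceFree (n + 1) p q ⊓ summand (simplexTangent (n + 1)) p q m)
        + finrank ℝ (leftDivisible (simplexBasis (n + 1)) Q (P + 1))
      = finrank ℝ (leftDivisible (simplexBasis (n + 1)) P (Q + 1)) := by
  have := finite_doubleCovector (simplexBasis (n + 1))
  have h1 := (bianchiStable_traceFree (n + 1)).finrank_inf_summand m hP hq hQ
  have h2 := finrank_bubbles_add (simplexBasis (n + 1)) P Q
  rw [← traceFree_eq_bubbles, ← traceFree_eq_bubbles] at h2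
  omega

theorem apply_eq_of_mem_polyForms_zero {n p q : ℕ} {φ : DoubleField n p q}
    (hφ : φ ∈ polyForms n p q 0) (x y : stdSimplex ℝ (Fin (n + 1))) : φ x = φ y := by
  ext X Y
  obtain ⟨P, hP, h⟩ := hφ X Y
  rw [MvPolynomial.totalDegree_eq_zero_iff_eq_C.1 (Nat.le_zero.1 hP)] at h
  have hx := h x
  have hy := h y
  rw [MvPolynomial.eval_C] at hx hy
  exact hx.trans hy.symm

/-- Double covectors as constant fields. -/
noncomputable def constField (n p q : ℕ) :
    DoubleCovector (simplexTangent n) p q →ₗ[ℝ] DoubleField n p q :=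
  LinearMap.pi fun _ => LinearMap.id

/-- A vertex of the simplex. -/
noncomputable def vertex {n : ℕ} (i : Fin (n + 1)) : stdSimplex ℝ (Fin (n + 1)) :=
  ⟨Pi.single i 1, single_mem_stdSimplex ℝ i⟩

theorem constField_injective (n p q : ℕ) : Function.Injective (constField n p q) :=
  fun _ _ h => congrFun h (vertex 0)

theorem map_constField (n p q m : ℕ) :
    (traceFree (n + 1) p q ⊓ summand (simplexTangent (n + 1)) p q m).map (constField (n + 1) p q)
      = traceFreePolyForms (n + 1) p q m 0 := by
  ext φ
  constructor
  · rintro ⟨ψ, ⟨h1, h2⟩, rfl⟩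
    refine ⟨⟨fun X Y => ⟨MvPolynomial.C (ψ X Y), ?_, fun x => ?_⟩, fun x _ => h2⟩,
      fun x i _ X Y hX hY => (Submodule.mem_iInf _).1 h1 i X Y hX hY⟩
    · rw [MvPolynomial.totalDegree_C]
    · rw [MvPolynomial.eval_C]; rfl
  · rintro ⟨⟨h1, h2⟩, h3⟩
    refine ⟨φ (vertex 0), ⟨(Submodule.mem_iInf _).2 fun i X Y hX hY => ?_, h2 _ trivial⟩,
      funext fun x => apply_eq_of_mem_polyForms_zero h1 _ _⟩
    -- In positive dimension the facet `i` is nonempty: it contains every vertex `j ≠ i`. By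
    -- constancy the trace condition there constrains the single value of the field.
    obtain ⟨j, hj⟩ := exists_ne i
    rw [apply_eq_of_mem_polyForms_zero h1 _ (vertex j)]
    exact h3 (vertex j) i (Pi.single_eq_of_ne hj.symm 1) X Y hX hY

theorem traceFreePolyForms_zero_left {p q m : ℕ} (hp : 0 < p) :
    traceFreePolyForms 0 p q m 0 = ⊥ :=
  (Submodule.eq_bot_iff _).2 fun φ _ => funext fun x =>
    doubleCovector_eq_zero_of_lt_left (simplexBasis 0) hp (φ x)

end Simplex

/-! ### Binomial identities. -/

section Binomials

theorem binom_natCast (a b : ℕ) : binom a (b : ℤ) = a.choose b := by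
  simp [binom]

theorem binom_of_neg (a : ℕ) {b : ℤ} (hb : b < 0) : binom a b = 0 := by
  rw [binom, if_neg (by omega)]

/-- Both sides are the multinomial coefficient `N! / (d! (N - P)! (N - Q)!)`. -/
theorem choose_mul_choose_eq {N P Q d : ℕ} (hP : P ≤ N) (hQ : Q ≤ N) (h : P + Q = N + d) :
    N.choose Q * Q.choose d = N.choose P * P.choose d := by
  rw [Nat.choose_mul (show d ≤ Q by omega), Nat.choose_mul (show d ≤ P by omega)]
  congr 1
  exact Nat.choose_symm_of_eq_add (by omega)

/-- With `d = P + Q - N ≥ 0`, Pascal's rule raises `N` to `N + 1` in both terms of `h1` at the cost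
of `N.choose Q * Q.choose d` and `N.choose P * P.choose d`, which are equal. Absorption, `(N + 1) *
N.choose k = (k + 1) * (N + 1).choose (k + 1)`, then makes the two terms proportional and yields the
product form. -/
theorem dimension_formulas {N P Q E : ℕ} (hQP : Q < P) (h0 : N < P → E = 0)
    (h1 : P ≤ N → E + N.choose (P + 1) * P.choose (N - Q) = N.choose (Q + 1) * Q.choose (N - P)) :
    (E : ℚ) = ((N + 1).choose (Q + 1) : ℚ) * binom Q ((P : ℤ) + Q - N)
        - ((N + 1).choose (P + 1) : ℚ) * binom P ((P : ℤ) + Q - N) ∧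
    (E : ℚ) = ((P : ℚ) - Q) / ((P : ℚ) + 1) * (N + 1).choose (Q + 1) * binom Q ((N : ℤ) - P) := by
  rcases lt_or_ge N P with hN | hN
  -- If `N < P`, the lower index `P + Q - N` exceeds `Q`, `P + 1` exceeds `N + 1`, and `N - P` is
  -- negative, so both formulas give zero.
  · have h2 : ((P : ℤ) + Q - N) = ((P + Q - N : ℕ) : ℤ) := by omega
    rw [h0 hN, h2, binom_natCast, binom_of_neg Q (by omega),
      Nat.choose_eq_zero_of_lt (show Q < P + Q - N by omega),
      Nat.choose_eq_zero_of_lt (show N + 1 < P + 1 by omega)]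
    simp
  have h1 := h1 hN
  have h3 : ((N : ℤ) - P) = ((N - P : ℕ) : ℤ) := by omega
  rw [h3, binom_natCast]
  rcases lt_or_ge (P + Q) N with h | h
  · rw [Nat.choose_eq_zero_of_lt (show P < N - Q by omega),
      Nat.choose_eq_zero_of_lt (show Q < N - P by omega)] at h1
    rw [Nat.choose_eq_zero_of_lt (show Q < N - P by omega), binom_of_neg _ (by omega),
      binom_of_neg _ (by omega)]
    have : E = 0 := by simpa using h1
    simp [this]
  · obtain ⟨d, hd⟩ := Nat.exists_eq_add_of_le h
    have h2 : ((P : ℤ) + Q - N) = (d : ℤ) := by omega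
    have h4 : P.choose (N - Q) = P.choose d := Nat.choose_symm_of_eq_add (by omega)
    have h5 : Q.choose (N - P) = Q.choose d := Nat.choose_symm_of_eq_add (by omega)
    have h6 := choose_mul_choose_eq hN (by omega) hd
    have h7 := Nat.add_one_mul_choose_eq N Q
    have h8 := Nat.add_one_mul_choose_eq N P
    rw [h4, h5] at h1
    rw [h2, binom_natCast, binom_natCast, h5]
    have h9 : (E : ℚ) = ((N + 1).choose (Q + 1) : ℚ) * Q.choose d
        - ((N + 1).choose (P + 1) : ℚ) * P.choose d := by
      rw [Nat.choose_succ_succ' N Q, Nat.choose_succ_succ' N P]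
      have h1' : (E : ℚ) + N.choose (P + 1) * P.choose d = N.choose (Q + 1) * Q.choose d := by
        exact_mod_cast h1
      have h6' : (N.choose Q : ℚ) * Q.choose d = N.choose P * P.choose d := by exact_mod_cast h6
      push_cast
      linarith
    refine ⟨h9, ?_⟩
    have h6' : (N.choose Q : ℚ) * Q.choose d = N.choose P * P.choose d := by exact_mod_cast h6
    have h7' : ((N : ℚ) + 1) * N.choose Q = (N + 1).choose (Q + 1) * (Q + 1) := by
      exact_mod_cast h7
    have h8' : ((N : ℚ) + 1) * N.choose P = (N + 1).choose (P + 1) * (P + 1) := by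
      exact_mod_cast h8
    have hP : (P : ℚ) + 1 ≠ 0 := by positivity
    rw [h9, div_mul_eq_mul_div, div_mul_eq_mul_div, eq_div_iff hP]
    linear_combination ((N : ℚ) + 1) * h6' - (Q.choose d : ℚ) * h7' + (P.choose d : ℚ) * h8'

end Binomials

end DoubleForms

theorem mainTheorem5 (n p q m : ℕ) (hm : (q : ℤ) - p ≤ m) (hmq : (m : ℤ) ≤ (q : ℤ) - 1) :
    FiniteDimensional ℝ (DoubleForms.traceFreePolyForms n p q m 0) ∧
    (Module.finrank ℝ (DoubleForms.traceFreePolyForms n p q m 0) : ℚ) =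
      (DoubleForms.binom (n + 1) ((q : ℤ) - m) : ℚ)
          * DoubleForms.binom (q - m - 1) ((p : ℤ) + q - n - 1)
        - (DoubleForms.binom (n + 1) ((p : ℤ) + m + 1) : ℚ)
          * DoubleForms.binom (p + m) ((p : ℤ) + q - n - 1) ∧
    (Module.finrank ℝ (DoubleForms.traceFreePolyForms n p q m 0) : ℚ) =
      ((p : ℚ) - q + 2 * m + 1) / ((p : ℚ) + m + 1)
        * DoubleForms.binom (n + 1) ((q : ℤ) - m)
        * DoubleForms.binom (q - m - 1) ((n : ℤ) - p - m) := by
  -- The bound `m ≤ q - 1` makes `Q = q - m - 1` a natural number, and `q - p ≤ m` becomes `Q + 1 ≤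
  -- p`; in particular `p > 0`.
  obtain ⟨Q, rfl⟩ : ∃ Q, q = Q + 1 + m := ⟨q - 1 - m, by omega⟩
  have hQ : Q + 1 ≤ p := by omega
  have e1 : ((Q + 1 + m : ℕ) : ℤ) - m = (Q + 1 : ℕ) := by omega
  have e2 : Q + 1 + m - m - 1 = Q := by omega
  have e3 : (p : ℤ) + (Q + 1 + m : ℕ) - n - 1 = ((p + m : ℕ) : ℤ) + Q - n := by omega
  have e4 : (p : ℤ) + m + 1 = (p + m + 1 : ℕ) := by omega
  have e5 : (n : ℤ) - p - m = (n : ℤ) - (p + m : ℕ) := by omega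
  have e6 : (p : ℚ) - (Q + 1 + m : ℕ) + 2 * m + 1 = ((p + m : ℕ) : ℚ) - Q := by push_cast; ring
  have e7 : (p : ℚ) + m + 1 = ((p + m : ℕ) : ℚ) + 1 := by push_cast; ring
  rw [e1, e2, e3, e4, e5, e6, e7, DoubleForms.binom_natCast, DoubleForms.binom_natCast]
  cases n with
  | zero =>
    -- A point has no boundary, so the trace condition is empty; the space vanishes because `H = 0`
    -- and `p > 0`.
    rw [DoubleForms.traceFreePolyForms_zero_left (by omega)]
    exact ⟨inferInstance, DoubleForms.dimension_formulas (by omega)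
      (fun _ => finrank_bot ℝ _) (fun h => by omega)⟩
  | succ n =>
    have := DoubleForms.finite_doubleCovector (DoubleForms.simplexBasis (n + 1))
    rw [← DoubleForms.map_constField]
    refine ⟨inferInstance, ?_⟩
    rw [← (Submodule.equivMapOfInjective _ (DoubleForms.constField_injective (n + 1) p _)
      _).finrank_eq]
    have h := DoubleForms.finrank_traceFree_inf_summand_add n m (p := p) (Q := Q) rfl rfl hQ
    refine DoubleForms.dimension_formulas (by omega) (fun hN => ?_) fun hN => ?_
    · rw [DoubleForms.finrank_leftDivisible_of_lt (a := p + m) _ hN] at h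
      omega
    · rw [DoubleForms.finrank_leftDivisible _ (p + m) (a := Q) (c := n + 1 - Q) (by omega),
        DoubleForms.finrank_leftDivisible _ Q (a := p + m) (c := n + 1 - (p + m)) (by omega)] at h
      exact h
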